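/- For an $N$-bit string $x$, the quasi B-oracle hiding $x$ answers a query $q\in\{0,1\}^N$ with a random bit $\zeta(x;q)$, where, writing $m=wt(x\wedge q)$ for the Hamming weight of the bitwise AND of $x$ and $q$, $$\Pr[\zeta(x;q)=0]=\begin{cases}0 & m \text{ odd},\\ \sqrt{1/m} & m \text{ even and positive},\\ 1 & m=0,\end{cases}\qquad \Pr[\zeta(x;q)=1]=1-\Pr[\zeta(x;q)=0].$$ It is accessed by quantum algorithms as the unitary $$\widetilde O_x|q,a,z\rangle=\sqrt{\Pr[\zeta(x;q)=0]}\,|q,a,z\rangle+(-1)^a\sqrt{\Pr[\zeta(x;q)=1]}\,|q,a\oplus 1,z\rangle,$$ where $q\in\{0,1\}^N$ is the query register, $a\in\{0,1\}$ the answer register and $z$ the content of a finite work register. A $T$-query quantum algorithm prepares $U_T\widetilde O_xU_{T-1}\cdots U_1\widetilde O_xU_0|0\rangle$, where the unitaries $U_0,\dots,U_T$ do not depend on $x$, measures this state in the computational basis, and outputs a string determined by the measurement result. Theorem. There is a constant $C>0$ such that for all integers $N$ and $k$ with $0\le k<N/2$ there is a quantum algorithm that makes at most $C\,k^{1/4}$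 queries to the quasi B-oracle and that, for every $x\in\{0,1\}^N$ of Hamming weight $k$, outputs $x$ with probability $1$. -/

import Mathlib

namespace QuasiB

/-- `N`-bit strings: the hidden strings `x` and the query strings `q`. -/
abbrev Str (N : ℕ) : Type := Fin N → Bool

/-- The Hamming weight of a bit string. -/
def wt {N : ℕ} (x : Str N) : ℕ := (Finset.univ.filter fun i => x i = true).card

/-- The bitwise AND of two bit strings. -/
def band {N : ℕ} (x q : Str N) : Str N := fun i => x i && q i

/-- `Pr[ζ(x;q) = 0]` for the quasi B-oracle, the probability of the answer "balanced". -/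
noncomputable def probZero {N : ℕ} (x q : Str N) : ℝ :=
  if Odd (wt (band x q)) then 0
  else if wt (band x q) = 0 then 1
  else Real.sqrt (1 / (wt (band x q) : ℝ))

/-- `Pr[ζ(x;q) = 1]` for the quasi B-oracle, the probability of the answer "tilted". -/
noncomputable def probOne {N : ℕ} (x q : Str N) : ℝ := 1 - probZero x q

/-- Labels of the computational basis states `|q, a, z⟩`: query register, answer bit,
work register. -/
abbrev Basis (N : ℕ) (W : Type) : Type := Str N × Bool × W

/-- The quasi B-oracle with hidden string `x`, as a matrix (row = target, column = source) in the
computational basis: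
`|q,a,z⟩ ↦ √Pr[ζ(x;q)=0] |q,a,z⟩ + (-1)^a √Pr[ζ(x;q)=1] |q,a⊕1,z⟩`. -/
noncomputable def oracle {N : ℕ} (W : Type) [DecidableEq W] (x : Str N) :
    Matrix (Basis N W) (Basis N W) ℂ :=
  fun r c =>
    if r.1 = c.1 ∧ r.2.2 = c.2.2 then
      if r.2.1 = c.2.1 then ((Real.sqrt (probZero x c.1) : ℝ) : ℂ)
      else (if c.2.1 then -1 else 1) * ((Real.sqrt (probOne x c.1) : ℝ) : ℂ)
    else 0

/-- A quantum query algorithm on `N`-bit hidden strings: a finite work register with its initial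
basis state, the number of queries, unitaries `U 0, U 1, …` that do not depend on the hidden string
(only `U 0, …, U queries` are used), and the reading of the string that is output from the
result of the final measurement in the computational basis. -/
structure QueryAlgorithm (N : ℕ) where
  W : Type
  [fintypeW : Fintype W]
  [decEqW : DecidableEq W]
  zeroW : W
  queries : ℕ
  U : ℕ → Matrix.unitaryGroup (Basis N W) ℂ
  output : Basis N W → Str N

attribute [instance] QueryAlgorithm.fintypeW QueryAlgorithm.decEqW

namespace QueryAlgorithm

/-- The all-zero initial state. -/
def initState {N : ℕ} (A : QueryAlgorithm N) : Basis N A.W → ℂ :=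
  Pi.single ((fun _ => false), false, A.zeroW) 1

/-- The state `U_t O_x U_{t-1} ⋯ U_1 O_x U_0 |0⟩` after `t` queries to the oracle hiding `x`. -/
noncomputable def state {N : ℕ} (A : QueryAlgorithm N) (x : Str N) : ℕ → (Basis N A.W → ℂ)
  | 0 => (A.U 0 : Matrix (Basis N A.W) (Basis N A.W) ℂ).mulVec A.initState
  | t + 1 => (A.U (t + 1) : Matrix (Basis N A.W) (Basis N A.W) ℂ).mulVec
      ((oracle A.W x).mulVec (A.state x t))

/-- The probability that the algorithm outputs `y` when the oracle hides `x`. -/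
noncomputable def outputProb {N : ℕ} (A : QueryAlgorithm N) (x y : Str N) : ℝ :=
  ∑ b : Basis N A.W, if A.output b = y then ‖A.state x A.queries b‖ ^ 2 else 0

end QueryAlgorithm

end QuasiB

open Matrix
open scoped Kronecker

namespace QuasiB

/-! ### The Walsh–Hadamard transform -/

/-- The one-qubit Hadamard matrix. -/
noncomputable def had1 (a b : Bool) : ℝ := (if a && b then -1 else 1) / Real.sqrt 2

lemma had1_comm (a b : Bool) : had1 a b = had1 b a := by
  simp [had1, Bool.and_comm]

lemma had1_mul_had1 (a b : Bool) : ∑ c, had1 a c * had1 c b = if a = b then 1 else 0 := by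
  have h : Real.sqrt 2 * Real.sqrt 2 = 2 := Real.mul_self_sqrt (by norm_num)
  rw [Fintype.sum_bool]
  simp only [had1, div_mul_div_comm, h]
  cases a <;> cases b <;> simp <;> norm_num

/-- The Walsh–Hadamard matrix on `N` qubits. -/
noncomputable def had (N : ℕ) : Matrix (Str N) (Str N) ℂ :=
  fun y q => ((∏ i, had1 (y i) (q i) : ℝ) : ℂ)

lemma had_conjTranspose (N : ℕ) : (had N)ᴴ = had N := by
  ext y q
  simp [had, Matrix.conjTranspose_apply, had1_comm]

lemma had_mul_had (N : ℕ) : had N * had N = 1 := by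
  ext y y'
  rw [Matrix.mul_apply]
  simp only [had]
  norm_cast
  simp only [← Finset.prod_mul_distrib]
  rw [← Fintype.piFinset_univ, ← Finset.prod_univ_sum (fun _ => Finset.univ)
    (fun i c => had1 (y i) c * had1 c (y' i))]
  simp only [had1_mul_had1]
  rw [Matrix.one_apply]
  by_cases h : y = y'
  · simp [h]
  · obtain ⟨i, hi⟩ := Function.ne_iff.1 h
    rw [if_neg h, Finset.prod_eq_zero (Finset.mem_univ i) (by simp [hi])]
    simp

/-- The character `(-1)^(y·q)`. -/
def chi {N : ℕ} (y q : Str N) : ℝ := ∏ i, if y i && q i then -1 else 1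

lemma chi_eq {N : ℕ} (y q : Str N) : chi y q = (-1) ^ wt (band y q) := by
  simp [chi, wt, band, Finset.prod_ite]

lemma had_mul_had_zero {N : ℕ} (y q : Str N) :
    had N y q * had N q (fun _ => false) = (((2 : ℝ) ^ N)⁻¹ * chi y q : ℝ) := by
  have h : Real.sqrt 2 * Real.sqrt 2 = 2 := Real.mul_self_sqrt (by norm_num)
  simp only [had, chi]
  rw [← Complex.ofReal_mul, ← Finset.prod_mul_distrib]
  congr 1
  have h2 : ((2 : ℝ) ^ N)⁻¹ = ∏ _i : Fin N, (2 : ℝ)⁻¹ := by simp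
  rw [h2, ← Finset.prod_mul_distrib]
  refine Finset.prod_congr rfl fun i _ => ?_
  simp only [had1, div_mul_div_comm, h]
  simp [div_eq_inv_mul]

/-- Flip the bit `i`. -/
def flip {N : ℕ} (i : Fin N) (q : Str N) : Str N := Function.update q i (!q i)

lemma flip_flip {N : ℕ} (i : Fin N) (q : Str N) : flip i (flip i q) = q := by
  simp [flip]

lemma chi_flip {N : ℕ} {y : Str N} {i : Fin N} (hi : y i = true) (q : Str N) :
    chi y (flip i q) = -chi y q := by
  simp only [chi]
  rw [← Finset.mul_prod_erase _ _ (Finset.mem_univ i),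
    ← Finset.mul_prod_erase _ (fun j => if y j && q j then (-1 : ℝ) else 1) (Finset.mem_univ i)]
  rw [Finset.prod_congr rfl (g := fun j => if y j && q j then (-1 : ℝ) else 1)]
  · cases h : q i <;> simp [flip, hi, h]
  · intro j hj
    simp [flip, Function.update_of_ne (Finset.ne_of_mem_erase hj)]

lemma sum_chi_mul_eq_zero {N : ℕ} {y : Str N} {i : Fin N} (hi : y i = true) (f : Str N → ℝ)
    (hf : ∀ q, f (flip i q) = f q) : ∑ q, chi y q * f q = 0 := by
  refine Finset.sum_involution (fun q _ => flip i q) ?_ ?_ ?_ ?_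
  · intro q _
    rw [chi_flip hi, hf]; ring
  · intro q _ _ h
    have := congrFun h i
    simp [flip] at this
  · simp
  · intro q _
    exact flip_flip i q

lemma probZero_flip {N : ℕ} {x : Str N} {i : Fin N} (hi : x i = false) (q : Str N) :
    probZero x (flip i q) = probZero x q := by
  have : band x (flip i q) = band x q := by
    ext j
    by_cases h : j = i
    · subst h; simp [band, hi]
    · simp [band, flip, h]
  simp [probZero, this]

/-! ### The oracle -/

lemma probZero_nonneg {N : ℕ} (x q : Str N) : 0 ≤ probZero x q := by
  unfold probZero
  split_ifs
  · rfl
  · norm_num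
  · exact Real.sqrt_nonneg _

lemma probZero_le_one {N : ℕ} (x q : Str N) : probZero x q ≤ 1 := by
  unfold probZero
  split_ifs with _ h
  · norm_num
  · rfl
  · rw [Real.sqrt_le_one]
    have : (1 : ℝ) ≤ wt (band x q) := by exact_mod_cast Nat.one_le_iff_ne_zero.2 h
    rw [div_le_one (by linarith)]
    exact this

lemma sqrt_prob_sq_add {N : ℕ} (x q : Str N) :
    ((Real.sqrt (probZero x q) : ℝ) : ℂ) * (Real.sqrt (probZero x q) : ℝ)
      + ((Real.sqrt (probOne x q) : ℝ) : ℂ) * (Real.sqrt (probOne x q) : ℝ) = 1 := by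
  norm_cast
  rw [Real.mul_self_sqrt (probZero_nonneg x q),
    Real.mul_self_sqrt (show 0 ≤ probOne x q from sub_nonneg.2 (probZero_le_one x q)), probOne]
  ring

section Oracle

variable {N : ℕ} (W : Type) [Fintype W] [DecidableEq W]

lemma oracle_mulVec (x : Str N) (v : Basis N W → ℂ) (q : Str N) (a : Bool) (z : W) :
    (oracle W x *ᵥ v) (q, a, z) = (Real.sqrt (probZero x q) : ℝ) * v (q, a, z)
      + (if a then 1 else -1) * (Real.sqrt (probOne x q) : ℝ) * v (q, !a, z) := by
  have hs : ∀ c ∉ ({(q, a, z), (q, !a, z)} : Finset (Basis N W)),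
      oracle W x (q, a, z) c * v c = 0 := by
    rintro ⟨q', a', z'⟩ hc
    rw [oracle, if_neg, zero_mul]
    rintro ⟨h1, h2⟩
    dsimp only at h1 h2
    subst h1 h2
    cases a <;> cases a' <;> simp at hc
  rw [Matrix.mulVec, dotProduct, ← Finset.sum_subset (Finset.subset_univ _) fun c _ => hs c,
    Finset.sum_pair (by simp)]
  cases a <;> simp [oracle]

/-- The phase `(-1)^a` on the answer bit. -/
def phase : Matrix (Basis N W) (Basis N W) ℂ :=
  Matrix.diagonal fun b => if b.2.1 then -1 else 1

lemma oracle_conjTranspose (x : Str N) :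
    (oracle W x)ᴴ = phase W * oracle W x * phase W := by
  ext ⟨q, a, z⟩ ⟨q', a', z'⟩
  rw [phase, Matrix.mul_diagonal, Matrix.diagonal_mul, Matrix.conjTranspose_apply]
  by_cases h : q = q' ∧ z = z'
  · obtain ⟨rfl, rfl⟩ := h
    cases a <;> cases a' <;> simp [oracle]
  · have h' : ¬ (q' = q ∧ z' = z) := fun h2 => h ⟨h2.1.symm, h2.2.symm⟩
    simp [oracle, h, h']

lemma oracle_unitary (x : Str N) : (oracle W x)ᴴ * oracle W x = 1 := by
  rw [oracle_conjTranspose]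
  apply Matrix.ext_of_mulVec_single
  intro i
  rw [← Matrix.mulVec_mulVec, ← Matrix.mulVec_mulVec, ← Matrix.mulVec_mulVec, Matrix.one_mulVec]
  generalize (Pi.single i 1 : Basis N W → ℂ) = v
  ext ⟨q, a, z⟩
  have h := sqrt_prob_sq_add x q
  simp only [phase, Matrix.mulVec_diagonal, oracle_mulVec]
  cases a
  · simp
    linear_combination v (q, false, z) * h
  · simp
    linear_combination v (q, true, z) * h

end Oracle

/-! ### Amplitude amplification -/

section Amplification

variable {ι : Type*} [DecidableEq ι]

/-- The diagonal reflection that negates the basis states satisfying `p`. -/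
def negOn (p : ι → Prop) [DecidablePred p] : Matrix ι ι ℂ :=
  Matrix.diagonal fun b => if p b then -1 else 1

lemma negOn_conjTranspose (p : ι → Prop) [DecidablePred p] : (negOn p)ᴴ = negOn p := by
  rw [negOn, Matrix.diagonal_conjTranspose]
  congr 1
  ext b
  by_cases h : p b <;> simp [h]

variable [Fintype ι]

lemma negOn_mul_negOn (p : ι → Prop) [DecidablePred p] : negOn p * negOn p = 1 := by
  rw [negOn, Matrix.diagonal_mul_diagonal, ← Matrix.diagonal_one]
  congr 1
  ext b
  by_cases h : p b <;> simp [h]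

/-- A Hermitian involution as a unitary. -/
def unitaryOfInvolution (M : Matrix ι ι ℂ) (h : Mᴴ = M) (h' : M * M = 1) :
    Matrix.unitaryGroup ι ℂ :=
  ⟨M, by rw [Matrix.mem_unitaryGroup_iff, Matrix.star_eq_conjTranspose, h, h']⟩

lemma reflect_mulVec {V : Matrix ι ι ℂ} (hV : V * Vᴴ = 1) (e : ι) (w : ι → ℂ) :
    (V * negOn (· ≠ e) * Vᴴ) *ᵥ w
      = (2 * (star (V *ᵥ Pi.single e 1) ⬝ᵥ w)) • (V *ᵥ Pi.single e 1) - w := by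
  have h1 : ∀ u : ι → ℂ, negOn (· ≠ e) *ᵥ u = (2 * u e) • Pi.single e 1 - u := by
    intro u
    ext b
    rw [negOn, Matrix.mulVec_diagonal]
    by_cases h : b = e
    · subst h; simp; ring
    · simp [h]
  have h2 : (Vᴴ *ᵥ w) e = star (V *ᵥ Pi.single e 1) ⬝ᵥ w := by
    simp [Matrix.mulVec, dotProduct, Matrix.conjTranspose_apply]
  rw [← Matrix.mulVec_mulVec, ← Matrix.mulVec_mulVec, h1, Matrix.mulVec_sub, Matrix.mulVec_smul,
    Matrix.mulVec_mulVec, hV, Matrix.one_mulVec, h2]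

/-- One step of amplitude amplification in the plane of the good state `g` and the start state
`V e`, whose good component is `sin θ • g`. -/
lemma amplify_step {V : Matrix ι ι ℂ} (hV : V * Vᴴ = 1) (e g : ι) (p : ι → Prop)
    [DecidablePred p] (hg : p g) (θ : ℝ) (hθ : Real.cos θ ≠ 0)
    (hψ : ∀ b, p b → (V *ᵥ Pi.single e 1) b = if b = g then (Real.sin θ : ℂ) else 0)
    (φ : ℝ) (w : ι → ℂ)
    (hw : w = (Real.sin φ : ℂ) • Pi.single g 1 + ((Real.cos φ / Real.cos θ : ℝ) : ℂ) •
      (V *ᵥ Pi.single e 1 - (Real.sin θ : ℂ) • Pi.single g 1)) :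
    (V * negOn (· ≠ e) * Vᴴ) *ᵥ (negOn p *ᵥ w)
      = (Real.sin (φ + 2 * θ) : ℂ) • Pi.single g 1
        + ((Real.cos (φ + 2 * θ) / Real.cos θ : ℝ) : ℂ) •
          (V *ᵥ Pi.single e 1 - (Real.sin θ : ℂ) • Pi.single g 1) := by
  have hnorm : star (V *ᵥ Pi.single e 1) ⬝ᵥ (V *ᵥ Pi.single e (1 : ℂ)) = 1 := by
    rw [Matrix.star_mulVec, Matrix.dotProduct_mulVec, Matrix.vecMul_vecMul,
      mul_eq_one_comm.1 hV, Matrix.vecMul_one]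
    simp
  rw [reflect_mulVec hV]
  generalize V *ᵥ Pi.single e (1 : ℂ) = ψ at *
  have hflip : negOn p *ᵥ w = (-(Real.sin φ) : ℂ) • Pi.single g 1
      + ((Real.cos φ / Real.cos θ : ℝ) : ℂ) • (ψ - (Real.sin θ : ℂ) • Pi.single g 1) := by
    ext b
    rw [negOn, Matrix.mulVec_diagonal, hw]
    by_cases hb : p b
    · by_cases hbg : b = g
      · subst hbg; simp [hψ _ hb, hb]
      · simp [hψ _ hb, hbg]
    · have hbg : b ≠ g := fun h => hb (h ▸ hg)
      simp [hb, hbg]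
  have hψg : star ψ ⬝ᵥ Pi.single g 1 = (Real.sin θ : ℂ) := by
    rw [dotProduct_single_one, Pi.star_apply, hψ g hg, if_pos rfl]
    exact Complex.conj_ofReal _
  have hin : star ψ ⬝ᵥ (negOn p *ᵥ w)
      = ((-(Real.sin φ) * Real.sin θ + Real.cos φ * Real.cos θ : ℝ) : ℂ) := by
    rw [hflip, dotProduct_add, dotProduct_smul, dotProduct_smul, dotProduct_sub, dotProduct_smul,
      hψg, hnorm]
    simp only [smul_eq_mul]
    norm_cast
    have : (1 : ℝ) - Real.sin θ * Real.sin θ = Real.cos θ * Real.cos θ := by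
      linarith [Real.sin_sq_add_cos_sq θ, sq (Real.sin θ), sq (Real.cos θ)]
    rw [this]
    field_simp
  have hs : Real.sin (φ + 2 * θ) = Real.sin φ
      + 2 * Real.sin θ * (-(Real.sin φ) * Real.sin θ + Real.cos φ * Real.cos θ) := by
    rw [Real.sin_add, Real.sin_two_mul, Real.cos_two_mul']
    linear_combination (Real.sin φ) * Real.sin_sq_add_cos_sq θ
  have hc : Real.cos (φ + 2 * θ) / Real.cos θ =
      2 * (-(Real.sin φ) * Real.sin θ + Real.cos φ * Real.cos θ) - Real.cos φ / Real.cos θ := by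
    rw [Real.cos_add, Real.sin_two_mul, Real.cos_two_mul]
    field_simp
    ring
  rw [hin, hflip, hs, hc]
  ext b
  simp only [Pi.add_apply, Pi.sub_apply, Pi.smul_apply, smul_eq_mul]
  push_cast
  ring

end Amplification

/-! ### The algorithm -/

/-- The reflection of the ancilla that sends `|0⟩` to `c |0⟩ + √(1 - c²) |1⟩`. -/
noncomputable def ancilla (c : ℝ) : Matrix Bool Bool ℂ :=
  fun a b => ((if a = b then (if a then -c else c) else Real.sqrt (1 - c ^ 2) : ℝ) : ℂ)

lemma ancilla_conjTranspose (c : ℝ) : (ancilla c)ᴴ = ancilla c := by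
  ext a b
  cases a <;> cases b <;> simp [ancilla, Matrix.conjTranspose_apply]

lemma ancilla_mul_ancilla {c : ℝ} (hc : c ^ 2 ≤ 1) : ancilla c * ancilla c = 1 := by
  have h := Real.mul_self_sqrt (sub_nonneg.2 hc)
  ext a b
  rw [Matrix.mul_apply, Fintype.sum_bool]
  simp only [ancilla]
  norm_cast
  cases a <;> cases b <;> simp <;> norm_cast <;> nlinarith

/-- The preparation of the uniform superposition of all queries. -/
noncomputable def prep (N : ℕ) : Matrix (Basis N Bool) (Basis N Bool) ℂ := had N ⊗ₖ 1

/-- The Walsh–Hadamard transform of the query register together with the ancilla reflection. -/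
noncomputable def decode (N : ℕ) (c : ℝ) : Matrix (Basis N Bool) (Basis N Bool) ℂ :=
  had N ⊗ₖ ((1 : Matrix Bool Bool ℂ) ⊗ₖ ancilla c)

lemma prep_conjTranspose (N : ℕ) : (prep N)ᴴ = prep N := by
  simp [prep, Matrix.conjTranspose_kronecker, had_conjTranspose]

lemma prep_mul_prep (N : ℕ) : prep N * prep N = 1 := by
  rw [prep, ← Matrix.mul_kronecker_mul, had_mul_had, one_mul, Matrix.one_kronecker_one]

lemma decode_conjTranspose (N : ℕ) (c : ℝ) : (decode N c)ᴴ = decode N c := by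
  simp [decode, Matrix.conjTranspose_kronecker, had_conjTranspose, ancilla_conjTranspose]

lemma decode_mul_decode (N : ℕ) {c : ℝ} (hc : c ^ 2 ≤ 1) : decode N c * decode N c = 1 := by
  rw [decode, ← Matrix.mul_kronecker_mul, ← Matrix.mul_kronecker_mul, had_mul_had,
    ancilla_mul_ancilla hc, one_mul, Matrix.one_kronecker_one, Matrix.one_kronecker_one]

/-- The recognizable part of the decoded state: strings of weight `k`, answer and ancilla `0`. -/
def good (N k : ℕ) (b : Basis N Bool) : Prop := wt b.1 = k ∧ b.2.1 = false ∧ b.2.2 = false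

instance (N k : ℕ) : DecidablePred (good N k) := fun b => by unfold good; infer_instance

/-- The all-zero basis label. -/
def zeroLabel (N : ℕ) : Basis N Bool := (fun _ => false, false, false)

/-- The amplitude of `|x⟩` after a single query on the uniform superposition. -/
noncomputable def overlap {N : ℕ} (x : Str N) : ℝ :=
  ((2 : ℝ) ^ N)⁻¹ * ∑ q, Real.sqrt (probZero x q)

lemma chi_mul_sqrt_probZero {N : ℕ} (x q : Str N) :
    chi x q * Real.sqrt (probZero x q) = Real.sqrt (probZero x q) := by
  rw [chi_eq]
  rcases Nat.even_or_odd (wt (band x q)) with h | h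
  · simp [h.neg_one_pow]
  · simp [probZero, h]

lemma exists_of_wt_eq {N : ℕ} {x y : Str N} (h : wt y = wt x) (hne : y ≠ x) :
    ∃ i, y i = true ∧ x i = false := by
  by_contra hcon
  push Not at hcon
  apply hne
  have hsub : (Finset.univ.filter fun i => y i = true) ⊆ Finset.univ.filter fun i => x i = true := by
    intro i hi
    simp only [Finset.mem_filter, Finset.mem_univ, true_and] at hi ⊢
    simpa using hcon i hi
  have heq := Finset.eq_of_subset_of_card_le hsub (le_of_eq h.symm)
  ext i
  have := Finset.ext_iff.1 heq i
  simp only [Finset.mem_filter, Finset.mem_univ, true_and] at this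
  exact Bool.eq_iff_iff.2 this

lemma single_query_apply {N : ℕ} (x y : Str N) (c : ℝ) :
    ((decode N c * oracle Bool x * prep N) *ᵥ Pi.single (zeroLabel N) 1) (y, false, false)
      = ((c * (((2 : ℝ) ^ N)⁻¹ * ∑ q, chi y q * Real.sqrt (probZero x q)) : ℝ) : ℂ) := by
  rw [← Matrix.mulVec_mulVec, ← Matrix.mulVec_mulVec]
  have h1 : ∀ q a z, (prep N *ᵥ Pi.single (zeroLabel N) 1) (q, a, z)
      = if a = false ∧ z = false then had N q (fun _ => false) else 0 := by
    intro q a z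
    cases a <;> cases z <;> simp [prep, zeroLabel]
  have h2 : ∀ q z, (oracle Bool x *ᵥ (prep N *ᵥ Pi.single (zeroLabel N) 1)) (q, false, z)
      = if z = false then (Real.sqrt (probZero x q) : ℝ) * had N q (fun _ => false) else 0 := by
    intro q z
    rw [oracle_mulVec, h1, h1]
    cases z <;> simp
  rw [Matrix.mulVec, dotProduct, Fintype.sum_prod_type]
  push_cast
  rw [Finset.mul_sum, Finset.mul_sum]
  refine Finset.sum_congr rfl fun q _ => ?_
  rw [Fintype.sum_prod_type, Fintype.sum_bool, Fintype.sum_bool, Fintype.sum_bool, h2, h2]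
  have h3 := had_mul_had_zero y q
  push_cast at h3
  simp [decode, ancilla]
  linear_combination (c : ℂ) * (Real.sqrt (probZero x q) : ℝ) * h3

lemma single_query_good {N k : ℕ} {x : Str N} (hx : wt x = k) (c : ℝ) (b : Basis N Bool)
    (hb : good N k b) :
    ((decode N c * oracle Bool x * prep N) *ᵥ Pi.single (zeroLabel N) 1) b
      = if b = (x, false, false) then ((c * overlap x : ℝ) : ℂ) else 0 := by
  obtain ⟨y, a, z⟩ := b
  obtain ⟨hy, rfl, rfl⟩ : wt y = k ∧ a = false ∧ z = false := hb
  rw [single_query_apply]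
  by_cases h : y = x
  · subst h
    simp [overlap, chi_mul_sqrt_probZero]
  · obtain ⟨i, hi, hi'⟩ := exists_of_wt_eq (hy.trans hx.symm) h
    rw [sum_chi_mul_eq_zero hi _ fun q => by rw [probZero_flip hi']]
    simp [h]

lemma overlap_ge {N k : ℕ} (hk : 0 < k) {x : Str N} (hx : wt x = k) :
    1 / 2 * ((k : ℝ) ^ (1 / 4 : ℝ))⁻¹ ≤ overlap x := by
  have hkR : (0 : ℝ) < k := by exact_mod_cast hk
  set κ : ℝ := ((k : ℝ) ^ (1 / 4 : ℝ))⁻¹ with hκ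
  have hκ0 : 0 ≤ κ := by positivity
  have hκ' : κ = Real.sqrt (Real.sqrt (1 / k)) := by
    rw [hκ, Real.sqrt_eq_rpow, Real.sqrt_eq_rpow, ← Real.rpow_mul (by positivity),
      one_div (k : ℝ), Real.inv_rpow hkR.le]
    norm_num
  have hκ1 : κ ≤ 1 := by
    rw [hκ', Real.sqrt_le_one, Real.sqrt_le_one, div_le_one hkR]
    exact_mod_cast hk
  have hpt : ∀ q, κ * (1 / 2) * (1 + chi x q) ≤ Real.sqrt (probZero x q) := by
    intro q
    rw [chi_eq]
    rcases Nat.even_or_odd (wt (band x q)) with h | h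
    · rw [h.neg_one_pow]
      have h' : ¬ Odd (wt (band x q)) := Nat.not_odd_iff_even.2 h
      rw [probZero, if_neg h']
      split_ifs with h0
      · rw [Real.sqrt_one]; linarith
      · have hm : (0 : ℝ) < wt (band x q) := by exact_mod_cast Nat.pos_of_ne_zero h0
        have hle : (wt (band x q) : ℝ) ≤ k := by
          rw [← hx]
          norm_cast
          apply Finset.card_le_card
          intro i
          simp +contextual [band]
        have : κ * (1 / 2) * (1 + 1) = κ := by ring
        rw [this, hκ']
        apply Real.sqrt_le_sqrt
        apply Real.sqrt_le_sqrt
        exact one_div_le_one_div_of_le hm hle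
    · rw [h.neg_one_pow]
      simp
  obtain ⟨i, hi⟩ : ∃ i, x i = true := by
    have : (Finset.univ.filter fun i => x i = true).Nonempty := by
      rw [← Finset.card_pos]
      change 0 < wt x
      omega
    obtain ⟨i, hi⟩ := this
    exact ⟨i, by simpa using hi⟩
  have hchi : ∑ q, chi x q = 0 := by
    simpa using sum_chi_mul_eq_zero hi (fun _ => 1) fun _ => rfl
  have hsum : ∑ q : Str N, κ * (1 / 2) * (1 + chi x q) = κ * (1 / 2) * 2 ^ N := by
    rw [← Finset.mul_sum, Finset.sum_add_distrib, hchi]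
    simp
  have := Finset.sum_le_sum fun q (_ : q ∈ Finset.univ) => hpt q
  rw [hsum] at this
  rw [overlap, inv_mul_eq_div, le_div_iff₀ (by positivity)]
  linarith

lemma exists_perm {N : ℕ} {x y : Str N} (h : wt x = wt y) :
    ∃ σ : Equiv.Perm (Fin N), ∀ i, y (σ i) = x i := by
  have hc : Fintype.card {i // x i = true} = Fintype.card {i // y i = true} := by
    rw [Fintype.card_subtype, Fintype.card_subtype]
    exact h
  obtain ⟨e⟩ := Fintype.card_eq.1 hc
  refine ⟨e.extendSubtype, fun i => ?_⟩
  by_cases hi : x i = true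
  · rw [hi]
    exact e.extendSubtype_mem i hi
  · rw [Bool.eq_false_of_not_eq_true hi]
    simpa using e.extendSubtype_not_mem i hi

lemma overlap_eq_of_wt_eq {N : ℕ} {x y : Str N} (h : wt x = wt y) : overlap x = overlap y := by
  obtain ⟨σ, hσ⟩ := exists_perm h
  unfold overlap
  congr 1
  refine Fintype.sum_equiv (σ.arrowCongr (Equiv.refl Bool)) _ _ fun q => ?_
  have : wt (band x q) = wt (band y (σ.arrowCongr (Equiv.refl Bool) q)) := by
    refine Finset.card_bij (fun i _ => σ i) ?_ ?_ ?_
    · intro i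
      simp [band, hσ]
    · intro i _ j _ hij
      exact σ.injective hij
    · intro j hj
      refine ⟨σ.symm j, ?_, by simp⟩
      have hx := hσ (σ.symm j)
      rw [Equiv.apply_symm_apply] at hx
      simpa [band, ← hx] using hj
  simp only [probZero, this]

lemma exists_wt_eq {N k : ℕ} (h : k ≤ N) : ∃ x : Str N, wt x = k := by
  refine ⟨fun i => decide ((i : ℕ) < k), ?_⟩
  simp [wt, Fin.card_filter_val_lt, h]

/-- The unitaries of exact amplitude amplification with `n` rounds. -/
noncomputable def amplifier (N k n : ℕ) (c : ℝ) (hc : c ^ 2 ≤ 1) (t : ℕ) :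
    Matrix.unitaryGroup (Basis N Bool) ℂ :=
  let A := unitaryOfInvolution (prep N) (prep_conjTranspose N) (prep_mul_prep N)
  let B := unitaryOfInvolution (decode N c) (decode_conjTranspose N c) (decode_mul_decode N hc)
  let reflect (p : Basis N Bool → Prop) [DecidablePred p] :=
    unitaryOfInvolution (negOn p) (negOn_conjTranspose p) (negOn_mul_negOn p)
  if t = 0 then A
  else if t = 2 * n + 1 then B
  else if Even t then A * reflect (· ≠ zeroLabel N) * A * reflect (fun b => b.2.1 = true)
  else reflect (fun b => b.2.1 = true) * B * reflect (good N k) * B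

/-- Exact amplitude amplification with `n` rounds for strings of weight `k`. -/
noncomputable def amplification (N k n : ℕ) (c : ℝ) (hc : c ^ 2 ≤ 1) : QueryAlgorithm N where
  W := Bool
  zeroW := false
  queries := 2 * n + 1
  U := amplifier N k n c hc
  output := Prod.fst

lemma amplification_state {N k n : ℕ} {c : ℝ} (hc : c ^ 2 ≤ 1) {x : Str N} (hx : wt x = k)
    {θ : ℝ} (hθ : Real.cos θ ≠ 0) (hα : c * overlap x = Real.sin θ) (j : ℕ) (hj : j ≤ n) :
    decode N c *ᵥ (oracle Bool x *ᵥ (amplification N k n c hc).state x (2 * j))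
      = (Real.sin ((2 * j + 1) * θ) : ℂ) • Pi.single (x, false, false) 1
        + ((Real.cos ((2 * j + 1) * θ) / Real.cos θ : ℝ) : ℂ) •
          ((decode N c * oracle Bool x * prep N) *ᵥ Pi.single (zeroLabel N) 1
            - (Real.sin θ : ℂ) • Pi.single (x, false, false) 1) := by
  have hO : oracle Bool x * (oracle Bool x)ᴴ = 1 := mul_eq_one_comm.1 (oracle_unitary Bool x)
  have hVt : (decode N c * oracle Bool x * prep N)ᴴ
      = prep N * (phase Bool * oracle Bool x * phase Bool) * decode N c := by
    rw [Matrix.conjTranspose_mul, Matrix.conjTranspose_mul, prep_conjTranspose,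
      decode_conjTranspose, oracle_conjTranspose, Matrix.mul_assoc (prep N)]
  have hV : (decode N c * oracle Bool x * prep N) * (decode N c * oracle Bool x * prep N)ᴴ = 1 := by
    rw [Matrix.conjTranspose_mul, Matrix.conjTranspose_mul, prep_conjTranspose,
      decode_conjTranspose]
    calc _ = decode N c * (oracle Bool x * (prep N * prep N) * (oracle Bool x)ᴴ) * decode N c := by
          noncomm_ring
      _ = 1 := by rw [prep_mul_prep, mul_one, hO, mul_one, decode_mul_decode N hc]
  induction j with
  | zero =>
    have h0 : (amplification N k n c hc).state x 0 = prep N *ᵥ Pi.single (zeroLabel N) 1 := rfl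
    rw [Nat.mul_zero, h0, Matrix.mulVec_mulVec, Matrix.mulVec_mulVec]
    simp [div_self hθ]
  | succ j ih =>
    have hstep := amplify_step hV (zeroLabel N) (x, false, false) (good N k) ⟨hx, rfl, rfl⟩ θ hθ
      (fun b hb => by rw [single_query_good hx c b hb, hα]) _ _ (ih (by omega))
    have hang : (2 * ((j + 1 : ℕ) : ℝ) + 1) * θ = (2 * (j : ℝ) + 1) * θ + 2 * θ := by
      push_cast; ring
    have hodd : ((amplifier N k n c hc (2 * j + 1) : Matrix.unitaryGroup _ ℂ) :
        Matrix (Basis N Bool) (Basis N Bool) ℂ)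
        = phase Bool * decode N c * negOn (good N k) * decode N c := by
      simp only [amplifier]
      rw [if_neg (by omega), if_neg (by omega), if_neg (by simp)]
      rfl
    have heven : ((amplifier N k n c hc (2 * j + 2) : Matrix.unitaryGroup _ ℂ) :
        Matrix (Basis N Bool) (Basis N Bool) ℂ)
        = prep N * negOn (· ≠ zeroLabel N) * prep N * phase Bool := by
      simp only [amplifier]
      rw [if_neg (by omega), if_neg (by omega), if_pos ⟨j + 1, by omega⟩]
      rfl
    have hst : (amplification N k n c hc).state x (2 * (j + 1)) =
        (amplifier N k n c hc (2 * j + 2) : Matrix (Basis N Bool) (Basis N Bool) ℂ) *ᵥ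
          (oracle Bool x *ᵥ
            ((amplifier N k n c hc (2 * j + 1) : Matrix (Basis N Bool) (Basis N Bool) ℂ) *ᵥ
              (oracle Bool x *ᵥ (amplification N k n c hc).state x (2 * j)))) := rfl
    rw [hang, ← hstep, hst, hodd, heven, hVt]
    simp only [Matrix.mulVec_mulVec]
    congr 1
    noncomm_ring

lemma amplification_outputProb {N k n : ℕ} {c : ℝ} (hc : c ^ 2 ≤ 1) {x : Str N} (hx : wt x = k)
    (hn : 0 < n) (hα : c * overlap x = Real.sin (Real.pi / (2 * (2 * n + 1)))) :
    (amplification N k n c hc).outputProb x x = 1 := by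
  set θ := Real.pi / (2 * (2 * n + 1)) with hθ
  have hn' : (1 : ℝ) ≤ n := by exact_mod_cast hn
  have hcos : Real.cos θ ≠ 0 := by
    apply ne_of_gt
    apply Real.cos_pos_of_mem_Ioo
    have h1 : 0 < θ := by positivity
    refine ⟨by linarith [Real.pi_pos], ?_⟩
    rw [hθ]
    apply div_lt_div_of_pos_left Real.pi_pos (by norm_num)
    linarith
  have hang : (2 * (n : ℝ) + 1) * θ = Real.pi / 2 := by
    rw [hθ]; field_simp
  have h := amplification_state hc hx hcos hα n le_rfl
  rw [hang, Real.sin_pi_div_two, Real.cos_pi_div_two] at h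
  have hfin : (amplification N k n c hc).state x (2 * n + 1)
      = (Pi.single (x, false, false) 1 : Basis N Bool → ℂ) := by
    have hlast : ((amplifier N k n c hc (2 * n + 1) : Matrix.unitaryGroup _ ℂ) :
        Matrix (Basis N Bool) (Basis N Bool) ℂ) = decode N c := by
      simp only [amplifier]
      rw [if_neg (by omega), if_pos trivial]
      rfl
    have hst : (amplification N k n c hc).state x (2 * n + 1) =
        (amplifier N k n c hc (2 * n + 1) : Matrix (Basis N Bool) (Basis N Bool) ℂ) *ᵥ
          (oracle Bool x *ᵥ (amplification N k n c hc).state x (2 * n)) := rfl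
    rw [hst, hlast, h]
    simp only [Complex.ofReal_one, one_smul, zero_div, Complex.ofReal_zero, zero_smul, add_zero]
    rfl
  unfold QueryAlgorithm.outputProb
  change ∑ b : Basis N Bool, (if b.1 = x then
    ‖(amplification N k n c hc).state x (2 * n + 1) b‖ ^ 2 else 0) = 1
  rw [hfin, Finset.sum_eq_single (x, false, false)]
  · simp
  · intro b _ hb
    simp [hb]
  · simp

/-- The algorithm without queries that outputs the all-zero string. -/
def outputZero (N : ℕ) : QueryAlgorithm N where
  W := Unit
  zeroW := ()
  queries := 0
  U := fun _ => 1
  output := fun _ _ => false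

lemma outputZero_outputProb {N : ℕ} {x : Str N} (hx : wt x = 0) :
    (outputZero N).outputProb x x = 1 := by
  have hx0 : x = fun _ => false := by
    ext i
    have := Finset.card_eq_zero.1 hx
    simpa using Finset.filter_eq_empty_iff.1 this (Finset.mem_univ i)
  have hs : (outputZero N).state x 0
      = (Pi.single (fun _ => false, false, ()) 1 : Basis N Unit → ℂ) := by
    exact Matrix.one_mulVec _
  unfold QueryAlgorithm.outputProb
  change ∑ b : Basis N Unit, (if (fun _ => false) = x then
    ‖(outputZero N).state x 0 b‖ ^ 2 else 0) = 1
  rw [hs, Finset.sum_eq_single (fun _ => false, false, ())]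
  · simp [hx0]
  · intro b _ hb
    simp [hb]
  · simp

lemma exists_amplification {N k : ℕ} (hk : 0 < k) (hN : k ≤ N) :
    ∃ A : QueryAlgorithm N, (A.queries : ℝ) ≤ 7 * (k : ℝ) ^ (1 / 4 : ℝ) ∧
      ∀ x : Str N, wt x = k → A.outputProb x x = 1 := by
  have hkR : (1 : ℝ) ≤ k := by exact_mod_cast hk
  obtain ⟨x₀, hx₀⟩ := exists_wt_eq hN
  set r : ℝ := (k : ℝ) ^ (1 / 4 : ℝ) with hr
  have hr1 : 1 ≤ r := Real.one_le_rpow hkR (by norm_num)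
  set n := ⌈2 * r⌉₊ with hn
  have hn1 : 2 * r ≤ n := Nat.le_ceil _
  have hn2 : (n : ℝ) < 2 * r + 1 := Nat.ceil_lt_add_one (by linarith)
  have hα : 1 / 2 * r⁻¹ ≤ overlap x₀ := overlap_ge hk hx₀
  have hα0 : 0 < overlap x₀ := lt_of_lt_of_le (by positivity) hα
  set θ := Real.pi / (2 * (2 * n + 1)) with hθ
  have hθ0 : 0 ≤ θ := by positivity
  have hθ1 : θ ≤ 1 / 2 * r⁻¹ := by
    have : (1 : ℝ) / 2 * r⁻¹ = 4 / (8 * r) := by field_simp; norm_num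
    rw [this]
    exact div_le_div₀ (by norm_num) Real.pi_le_four (by positivity) (by linarith)
  have hs0 : 0 ≤ Real.sin θ := by
    apply Real.sin_nonneg_of_nonneg_of_le_pi hθ0
    apply div_le_self Real.pi_pos.le
    linarith
  have hs1 : Real.sin θ ≤ overlap x₀ := (Real.sin_le hθ0).trans (hθ1.trans hα)
  have hc : (Real.sin θ / overlap x₀) ^ 2 ≤ 1 :=
    pow_le_one₀ (by positivity) ((div_le_one hα0).2 hs1)
  refine ⟨amplification N k n _ hc, ?_, fun x hx => ?_⟩
  · change (((2 * n + 1 : ℕ)) : ℝ) ≤ _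
    push_cast
    linarith
  · apply amplification_outputProb hc hx
    · have : (0 : ℝ) < n := by linarith
      exact_mod_cast this
    · rw [overlap_eq_of_wt_eq (hx.trans hx₀.symm), div_mul_cancel₀ _ hα0.ne']

end QuasiB

theorem theorem3 :
    ∃ C : ℝ, 0 < C ∧ ∀ N k : ℕ, 2 * k < N →
      ∃ A : QuasiB.QueryAlgorithm N,
        (A.queries : ℝ) ≤ C * (k : ℝ) ^ (1 / 4 : ℝ) ∧
        ∀ x : QuasiB.Str N, QuasiB.wt x = k → A.outputProb x x = 1 := by
  refine ⟨7, by norm_num, fun N k hkN => ?_⟩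
  rcases Nat.eq_zero_or_pos k with rfl | hk
  · refine ⟨QuasiB.outputZero N, ?_, fun x hx => QuasiB.outputZero_outputProb hx⟩
    change ((0 : ℕ) : ℝ) ≤ _
    rw [Nat.cast_zero]
    positivity
  · exact QuasiB.exists_amplification hk (by omega)
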